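/- Let $n\ge 2$ and $0\le r\le n-1$. Let $\mathbb H^n$ be the open unit ball of $\mathbb R^n$ with the hyperbolic metric $g_{\mathbb H}=\frac{dx_1^2+\dots+dx_n^2}{((1-|x|^2)/2)^2}$, and give $\mathbb H^n\times\mathbb R$ the product metric $g_{\mathbb H}+dt^2$. A hypersurface $M$ of $\mathbb H^n\times\mathbb R$ means a smooth $n$-manifold with (possibly empty) boundary, smoothly immersed in $\mathbb H^n\times\mathbb R$, whose image is a closed subset of $\mathbb H^n\times\mathbb R$ (for instance, a properly immersed one); $\partial M$ denotes the image of its boundary. It is $r$-minimal if $H_{r+1}=0$ at every interior point, where $\binom{n}{r+1}H_{r+1}=\sum_{i_1<\dots<i_{r+1}}k_{i_1}\cdots k_{i_{r+1}}$ and $k_1,\dots,k_n$ are the principal curvatures with respect to a (local) unit normal. Compactify $\mathbb H^n\times\mathbb R$ as $\overline{B}\times[-\infty,+\infty]$, where $\overline B\subset\mathbb R^n$ is the closed unit ball. The ideal boundary $\partial_\infty(\mathbb H^n\times\mathbb R)=(S^{n-1}\times\mathbb R)\cup(\overline B\times\{\pm\infty\})$ consists of the cylinder $S^{n-1}\times\mathbb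 R$ together with the endpoints of all non-horizontal geodesics, and the asymptotic boundary $\partial_\infty M$ is the set of limit points of (the image of) $M$ in $\partial_\infty(\mathbb H^n\times\mathbb R)$. For reals $t_0\le t_1$ let $S=\mathbb H^n\times[t_0,t_1]$ and $\partial_\infty S=S^{n-1}\times[t_0,t_1]$. **Proposition.** Let $M$ be an $r$-minimal hypersurface in $\mathbb H^n\times\mathbb R$ such that $\partial M\subset S$ and $\partial_\infty M\subset\partial_\infty S$ (either or both of $\partial M$, $\partial_\infty M$ may be empty). Then $M\subset S$. -/

import Mathlib

open scoped Manifold ContDiff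

noncomputable section

namespace HypProduct

/-- The coordinate space `ℝⁿ × ℝ` in which `ℍⁿ × ℝ` (ball model times the line) sits. -/
abbrev Coord (n : ℕ) : Type := EuclideanSpace ℝ (Fin n) × ℝ

/-- `ℍⁿ × ℝ`: the open unit ball of `ℝⁿ` times `ℝ`. -/
def space (n : ℕ) : Set (Coord n) := {p | ‖p.1‖ < 1}

/-- The product metric `g_ℍ + dt²`, where `g_ℍ = |dx|² / ((1 - |x|²) / 2)²`. -/
def metric {n : ℕ} (p u v : Coord n) : ℝ :=
  inner ℝ u.1 v.1 / ((1 - ‖p.1‖ ^ 2) / 2) ^ 2 + u.2 * v.2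

/-- Christoffel symbols of the first kind of the Levi-Civita connection `∇`: for constant
coordinate fields `a`, `b`, `c`, this is `g (∇_a b) c` at `p`. -/
def christoffel {n : ℕ} (p a b c : Coord n) : ℝ :=
  (fderiv ℝ (fun q => metric q b c) p a + fderiv ℝ (fun q => metric q a c) p b
    - fderiv ℝ (fun q => metric q a b) p c) / 2

section LocalGeometry

variable {n : ℕ} (f : EuclideanSpace ℝ (Fin n) → Coord n) (y : EuclideanSpace ℝ (Fin n))

/-- First fundamental form of a local parametrization `f` at the parameter `y`. -/
def firstForm (u v : EuclideanSpace ℝ (Fin n)) : ℝ :=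
  metric (f y) (fderiv ℝ f y u) (fderiv ℝ f y v)

/-- `N` is a unit normal vector of the parametrized hypersurface `f` at the parameter `y`. -/
def IsUnitNormal (N : Coord n) : Prop :=
  metric (f y) N N = 1 ∧ ∀ u, metric (f y) (fderiv ℝ f y u) N = 0

/-- Second fundamental form `g (∇_u df(v)) N` of a local parametrization `f` at the
parameter `y` with respect to the normal vector `N`. -/
def secondForm (N : Coord n) (u v : EuclideanSpace ℝ (Fin n)) : ℝ :=
  metric (f y) (fderiv ℝ (fderiv ℝ f) y u v) N
    + christoffel (f y) (fderiv ℝ f y u) (fderiv ℝ f y v) N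

/-- Matrix, in the coordinate basis, of the operator `A` with `firstForm (A u) v = secondForm u v`.
Its eigenvalues are the principal curvatures. -/
def shapeMatrix (N : Coord n) : Matrix (Fin n) (Fin n) ℝ :=
  (Matrix.of fun i j =>
      firstForm f y (EuclideanSpace.single i 1) (EuclideanSpace.single j 1))⁻¹ *
    Matrix.of fun i j =>
      secondForm f y N (EuclideanSpace.single i 1) (EuclideanSpace.single j 1)

/-- The principal curvatures `k₁, …, kₙ`, with multiplicity. -/
def principalCurvatures (N : Coord n) : Multiset ℝ := (shapeMatrix f y N).charpoly.roots

/-- The mean curvature `H_j`, given by `(n choose j) H_j = ∑_{i₁ < … < i_j} k_{i₁} ⋯ k_{i_j}`. -/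
def meanCurvature (j : ℕ) (N : Coord n) : ℝ :=
  (principalCurvatures f y N).esymm j / (n.choose j : ℝ)

end LocalGeometry

section Hypersurfaces

variable {n : ℕ} [NeZero n] {M : Type*} [TopologicalSpace M] [ChartedSpace (EuclideanHalfSpace n) M]

/-- A smooth immersion of an `n`-manifold with (possibly empty) boundary into `ℍⁿ × ℝ`. -/
structure IsImmersedHypersurface (X : M → Coord n) : Prop where
  mem_space : ∀ p, X p ∈ space n
  contMDiff : ContMDiff (𝓡∂ n) 𝓘(ℝ, Coord n) ∞ X
  injective_mfderiv : ∀ p, Function.Injective (mfderiv (𝓡∂ n) 𝓘(ℝ, Coord n) X p)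

/-- `H_{r+1} = 0` at every interior point of the hypersurface, computed in a chart around the point
(the vanishing does not depend on the choice of the unit normal). -/
def IsRMinimal (r : ℕ) (X : M → Coord n) : Prop :=
  ∀ p ∈ (𝓡∂ n).interior M, ∀ N : Coord n,
    IsUnitNormal (X ∘ (extChartAt (𝓡∂ n) p).symm) (extChartAt (𝓡∂ n) p p) N →
    meanCurvature (X ∘ (extChartAt (𝓡∂ n) p).symm) (extChartAt (𝓡∂ n) p p) (r + 1) N = 0

/-- The finite boundary `∂M`, as a subset of `ℍⁿ × ℝ`. -/
def finiteBoundary (X : M → Coord n) : Set (Coord n) := X '' (𝓡∂ n).boundary M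

end Hypersurfaces

/-- The ideal boundary of `ℍⁿ × ℝ` inside (closed unit ball) `× [-∞, ∞]`: the cylinder `Sⁿ⁻¹ × ℝ`
together with the endpoints `(x, ±∞)`, `‖x‖ ≤ 1`, of the non-horizontal geodesics. -/
def idealBoundary (n : ℕ) : Set (EuclideanSpace ℝ (Fin n) × EReal) :=
  {q | ∃ t : ℝ, ‖q.1‖ = 1 ∧ q.2 = t} ∪ {q | ‖q.1‖ ≤ 1 ∧ (q.2 = ⊤ ∨ q.2 = ⊥)}

/-- The limit points of `A ⊆ ℍⁿ × ℝ` in the ideal boundary. -/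
def asymptoticBoundary {n : ℕ} (A : Set (Coord n)) : Set (EuclideanSpace ℝ (Fin n) × EReal) :=
  idealBoundary n ∩ closure ((fun p : Coord n => (p.1, (p.2 : EReal))) '' A)

/-- The closed slab `S = ℍⁿ × [t₀, t₁]`. -/
def slab (n : ℕ) (t₀ t₁ : ℝ) : Set (Coord n) := {p | p ∈ space n ∧ t₀ ≤ p.2 ∧ p.2 ≤ t₁}

/-- The asymptotic boundary `∂_∞ S = ∂_∞ ℍⁿ × [t₀, t₁]` of the slab. -/
def slabAtInfinity (n : ℕ) (t₀ t₁ : ℝ) : Set (EuclideanSpace ℝ (Fin n) × EReal) :=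
  {q | ‖q.1‖ = 1 ∧ (t₀ : EReal) ≤ q.2 ∧ q.2 ≤ (t₁ : EReal)}

end HypProduct

end

/-! Compare `M` with level sets of `σ t + ε (cosh ρ + 1)`, where `σ = 1` bounds the height above and
`σ = -1` bounds it below. If `M` rises past the level `c` that bounds its finite and asymptotic
boundaries, its part above a slightly higher level is compact (`isCompact_superlevel`). For small
`ε` the perturbed height is maximal there at a point still above that level
(`exists_isMaxOn_barrier`), hence at an interior local maximum on `M`. There the gradient `W` is
normal to `M`, and the second fundamental form along `W` plus the Hessian `ε cosh ρ g_ℍ` is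
nonpositive. No nonzero tangent vector is vertical, so the Hessian is positive on the tangent space.
All principal curvatures for `-W/|W|` are thus positive, and so is `H_{r+1}`
(`exists_unitNormal_meanCurvature_pos`), a contradiction. -/

noncomputable section

namespace HypProduct

/-! ### Positivity of symmetric functions of principal curvatures. -/

section LinearAlgebra

open scoped MatrixOrder Matrix

/-- Writing `A⁻¹ = Cᴴ C`, the product `A⁻¹ B` has the characteristic polynomial of the positive
definite `C B Cᴴ`: `n` positive real roots. Since `j ≤ n`, the symmetric sum is nonempty. -/
theorem esymm_roots_charpoly_inv_mul_pos {n : ℕ} {A B : Matrix (Fin n) (Fin n) ℝ}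
    (hA : A.PosDef) (hB : B.PosDef) {j : ℕ} (hj : j ≤ n) :
    0 < ((A⁻¹ * B).charpoly.roots).esymm j := by
  obtain ⟨C, hC, hCA⟩ := CStarAlgebra.isStrictlyPositive_iff_eq_star_mul_self.1
    hA.inv.isStrictlyPositive
  have hCinj : Function.Injective fun v => v ᵥ* C := Matrix.vecMul_injective_of_isUnit hC
  have hD : (C * B * Cᴴ).PosDef := hB.mul_mul_conjTranspose_same hCinj
  have hchar : (A⁻¹ * B).charpoly = (C * B * Cᴴ).charpoly := by
    rw [hCA, Matrix.mul_assoc, Matrix.charpoly_mul_comm, Matrix.star_eq_conjTranspose]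
  have hroots := hD.isHermitian.roots_charpoly_eq_eigenvalues
  have hpos : ∀ k ∈ (A⁻¹ * B).charpoly.roots, 0 < k := by
    rw [hchar, hroots]
    intro k hk
    obtain ⟨i, -, rfl⟩ := Multiset.mem_map.1 hk
    exact hD.eigenvalues_pos i
  have hcard : ((A⁻¹ * B).charpoly.roots).card = n := by
    rw [hchar, hroots]
    simp
  rw [Multiset.esymm]
  have hne : Multiset.powersetCard j (A⁻¹ * B).charpoly.roots ≠ ∅ := fun h => by
    have h' := congrArg Multiset.card h
    rw [Multiset.card_powersetCard, hcard, Multiset.empty_eq_zero, Multiset.card_zero] at h'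
    exact (Nat.choose_pos hj).ne' h'
  have hlt := Multiset.sum_lt_sum_of_nonempty (f := fun _ => (0 : ℝ)) hne fun s hs =>
    Multiset.prod_pos fun k hk => hpos k (Multiset.mem_of_le (Multiset.mem_powersetCard.1 hs).1 hk)
  simpa using hlt

theorem posDef_of_bilinear {n : ℕ}
    (B : EuclideanSpace ℝ (Fin n) →ₗ[ℝ] EuclideanSpace ℝ (Fin n) →ₗ[ℝ] ℝ)
    (hsymm : ∀ u v, B u v = B v u) (hpos : ∀ u, u ≠ 0 → 0 < B u u) :
    (Matrix.of fun i j : Fin n =>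
      B (EuclideanSpace.single i 1) (EuclideanSpace.single j 1)).PosDef := by
  refine Matrix.PosDef.of_dotProduct_mulVec_pos ?_ fun x hx => ?_
  · ext i j
    simpa using hsymm _ _
  · have h := hpos (WithLp.toLp 2 x) fun h => hx (by simpa using h)
    have hx' : WithLp.toLp 2 x = ∑ i, x i • EuclideanSpace.single i (1 : ℝ) := by
      ext j
      simp [Finset.sum_apply, Pi.single_apply]
    rw [hx'] at h
    simp only [map_sum, map_smul, LinearMap.sum_apply, LinearMap.smul_apply, smul_eq_mul,
      Finset.mul_sum] at h
    simp only [Matrix.mulVec, dotProduct, Finset.mul_sum, star_trivial, Matrix.of_apply]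
    refine h.trans_eq (Finset.sum_congr rfl fun i _ => Finset.sum_congr rfl fun j _ => ?_)
    rw [hsymm]
    ring

end LinearAlgebra

/-! ### The second derivative test and the Christoffel symbols of the product metric. -/

section Calculus

/-- A positive second derivative would make `x` a local minimum too, so `h` would be locally
constant, forcing `h'' = 0`. -/
theorem deriv_deriv_nonpos_of_isLocalMax {h h' : ℝ → ℝ} {h'' x : ℝ} (hmax : IsLocalMax h x)
    (hd : ∀ᶠ s in nhds x, HasDerivAt h (h' s) s) (hdd : HasDerivAt h' h'' x) : h'' ≤ 0 := by
  by_contra! hpos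
  have heq : deriv h =ᶠ[nhds x] h' := hd.mono fun s hs => hs.deriv
  have hdd' : deriv (deriv h) x = h'' := by rw [heq.deriv_eq, hdd.deriv]
  have hmin := isLocalMin_of_deriv_deriv_pos (by rwa [hdd']) hmax.deriv_eq_zero
    hd.self_of_nhds.continuousAt
  have hconst : h =ᶠ[nhds x] fun _ => h x := by
    filter_upwards [hmax, hmin] with s h1 h2 using le_antisymm h1 h2
  have : deriv h =ᶠ[nhds x] fun _ => 0 := by
    simpa using hconst.deriv
  rw [this.deriv_eq, deriv_const] at hdd'
  exact hpos.ne hdd'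

variable {n : ℕ}

theorem hasFDerivAt_metric {p : Coord n} (hp : p ∈ space n) (b c : Coord n) :
    HasFDerivAt (fun q : Coord n => metric q b c)
      ((16 * inner ℝ b.1 c.1 / (1 - ‖p.1‖ ^ 2) ^ 3) •
        (innerSL ℝ p.1).comp (ContinuousLinearMap.fst ℝ (EuclideanSpace ℝ (Fin n)) ℝ)) p := by
  have hs : 1 - ‖p.1‖ ^ 2 ≠ 0 := by
    have : ‖p.1‖ < 1 := hp
    nlinarith [norm_nonneg p.1]
  have h1 : HasFDerivAt (fun q : Coord n => ‖q.1‖ ^ 2)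
      (2 • (innerSL ℝ p.1).comp (ContinuousLinearMap.fst ℝ (EuclideanSpace ℝ (Fin n)) ℝ)) p :=
    hasFDerivAt_fst.norm_sq
  have h2 : HasDerivAt (fun x : ℝ => inner ℝ b.1 c.1 / ((1 - x) / 2) ^ 2 + b.2 * c.2)
      (8 * inner ℝ b.1 c.1 / (1 - ‖p.1‖ ^ 2) ^ 3) (‖p.1‖ ^ 2) := by
    have h3 := (((hasDerivAt_const (‖p.1‖ ^ 2) (inner ℝ b.1 c.1 : ℝ)).div
      ((((hasDerivAt_id (‖p.1‖ ^ 2)).const_sub 1).div_const 2).pow 2)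
      (by simpa using hs)).add_const (b.2 * c.2))
    refine h3.congr_deriv ?_
    have hs' : (1 - ‖p.1‖ ^ 2) / 2 ≠ 0 := by simpa using hs
    simp only [id, Pi.pow_apply]
    field_simp
    ring
  refine (h2.comp_hasFDerivAt p h1).congr_fderiv ?_
  ext v
  all_goals simp
  ring

theorem christoffel_eq {p : Coord n} (hp : p ∈ space n) (a b c : Coord n) :
    christoffel p a b c = 8 / (1 - ‖p.1‖ ^ 2) ^ 3 *
      (inner ℝ b.1 c.1 * inner ℝ p.1 a.1 + inner ℝ a.1 c.1 * inner ℝ p.1 b.1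
        - inner ℝ a.1 b.1 * inner ℝ p.1 c.1) := by
  simp only [christoffel, (hasFDerivAt_metric hp _ _).fderiv]
  simp
  ring

end Calculus

/-! ### First and second derivatives of the barrier along curves. -/

section Barrier

variable {n : ℕ}

/-- The function `σ t + ε (cosh ρ + 1)`, with `ρ` the hyperbolic distance to the origin. -/
def barrier (σ ε : ℝ) (p : Coord n) : ℝ := σ * p.2 + ε * (2 / (1 - ‖p.1‖ ^ 2))

/-- The gradient of `barrier σ ε` for the product metric. -/
def barrierGrad (σ ε : ℝ) (p : Coord n) : Coord n := (ε • p.1, σ)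

theorem one_sub_norm_sq_pos {p : Coord n} (hp : p ∈ space n) : 0 < 1 - ‖p.1‖ ^ 2 := by
  have : ‖p.1‖ < 1 := hp
  nlinarith [norm_nonneg p.1]

theorem hasDerivAt_barrier_comp {c : ℝ → Coord n} {v : Coord n} {s : ℝ}
    (hc : HasDerivAt c v s) (hs : c s ∈ space n) (σ ε : ℝ) :
    HasDerivAt (fun x => barrier σ ε (c x)) (metric (c s) v (barrierGrad σ ε (c s))) s := by
  have hpos := one_sub_norm_sq_pos hs
  have h1 : HasDerivAt (fun x => (c x).1) v.1 s := hc.fst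
  have h2 : HasDerivAt (fun x => (c x).2) v.2 s := hc.snd
  refine ((h2.const_mul σ).add
    (((hasDerivAt_const s (2 : ℝ)).div (h1.norm_sq.const_sub 1) hpos.ne').const_mul ε)).congr_deriv ?_
  simp only [metric, barrierGrad, inner_smul_right, real_inner_comm v.1]
  field_simp
  ring

/-- The second derivative of the barrier along a curve: the Hessian of `barrier σ ε` at `(x, t)` is
`ε ((1 + |x|²) / (1 - |x|²)) g_ℍ`. -/
theorem hasDerivAt_metric_barrierGrad {c c' : ℝ → Coord n} {w : Coord n} {s : ℝ}
    (hc : HasDerivAt c (c' s) s) (hc' : HasDerivAt c' w s) (hs : c s ∈ space n) (σ ε : ℝ) :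
    HasDerivAt (fun x => metric (c x) (c' x) (barrierGrad σ ε (c x)))
      (metric (c s) w (barrierGrad σ ε (c s))
        + christoffel (c s) (c' s) (c' s) (barrierGrad σ ε (c s))
        + 4 * ε * (1 + ‖(c s).1‖ ^ 2) * ‖(c' s).1‖ ^ 2 / (1 - ‖(c s).1‖ ^ 2) ^ 3) s := by
  have hpos := one_sub_norm_sq_pos hs
  have h1 : HasDerivAt (fun x => (c x).1) (c' s).1 s := hc.fst
  have h1' : HasDerivAt (fun x => (c' x).1) w.1 s := hc'.fst
  have h2' : HasDerivAt (fun x => (c' x).2) w.2 s := hc'.snd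
  have h3 := ((h1'.inner ℝ (h1.const_smul ε)).div (((h1.norm_sq.const_sub 1).div_const 2).pow 2)
    (by simpa using hpos.ne')).add (h2'.mul_const σ)
  refine h3.congr_deriv ?_
  rw [christoffel_eq hs]
  simp only [metric, barrierGrad, inner_smul_right, real_inner_self_eq_norm_sq,
    real_inner_comm (c s).1, Pi.pow_apply, Pi.smul_apply]
  field_simp
  ring

/-- The curve need not be a geodesic: the first two terms of the inequality pair its covariant
acceleration with the gradient, which on a hypersurface becomes the second fundamental form. -/
theorem metric_barrierGrad_of_isLocalMax {c c' : ℝ → Coord n} {w : Coord n} {s : ℝ}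
    (hc : ∀ᶠ x in nhds s, HasDerivAt c (c' x) x) (hc' : HasDerivAt c' w s) (hs : c s ∈ space n)
    {σ ε : ℝ} (hmax : IsLocalMax (fun x => barrier σ ε (c x)) s) :
    metric (c s) (c' s) (barrierGrad σ ε (c s)) = 0 ∧
      metric (c s) w (barrierGrad σ ε (c s))
        + christoffel (c s) (c' s) (c' s) (barrierGrad σ ε (c s))
        + 4 * ε * (1 + ‖(c s).1‖ ^ 2) * ‖(c' s).1‖ ^ 2 / (1 - ‖(c s).1‖ ^ 2) ^ 3 ≤ 0 := by
  have hsp : ∀ᶠ x in nhds s, c x ∈ space n := hc.self_of_nhds.continuousAt.eventually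
    ((isOpen_lt continuous_fst.norm continuous_const).mem_nhds hs)
  have hd : ∀ᶠ x in nhds s, HasDerivAt (fun x => barrier σ ε (c x))
      (metric (c x) (c' x) (barrierGrad σ ε (c x))) x := by
    filter_upwards [hc, hsp] with x h1 h2 using hasDerivAt_barrier_comp h1 h2 σ ε
  exact ⟨hmax.hasDerivAt_eq_zero hd.self_of_nhds, deriv_deriv_nonpos_of_isLocalMax hmax hd
    (hasDerivAt_metric_barrierGrad hc.self_of_nhds hc' hs σ ε)⟩

theorem metric_self_pos {p a : Coord n} (hp : p ∈ space n) (ha : a ≠ 0) : 0 < metric p a a := by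
  have hpos := one_sub_norm_sq_pos hp
  rw [metric, real_inner_self_eq_norm_sq]
  by_cases h1 : a.1 = 0
  · have h2 : a.2 ≠ 0 := fun h2 => ha (Prod.ext h1 h2)
    have := mul_self_pos.2 h2
    positivity
  · have := norm_pos_iff.2 h1
    have := mul_self_nonneg a.2
    positivity

/-- The product metric as a bilinear map. -/
def metricBilin (p : Coord n) : Coord n →ₗ[ℝ] Coord n →ₗ[ℝ] ℝ :=
  LinearMap.mk₂ ℝ (metric p)
    (fun u u' v => by simp only [metric, Prod.fst_add, Prod.snd_add, inner_add_left]; ring)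
    (fun k u v => by
      simp only [metric, Prod.smul_fst, Prod.smul_snd, real_inner_smul_left, smul_eq_mul]; ring)
    (fun u v v' => by simp only [metric, Prod.fst_add, Prod.snd_add, inner_add_right]; ring)
    (fun k u v => by
      simp only [metric, Prod.smul_fst, Prod.smul_snd, real_inner_smul_right, smul_eq_mul]; ring)

/-- The Christoffel symbols as a bilinear map in the first two arguments. -/
def christoffelBilin {p : Coord n} (hp : p ∈ space n) (c : Coord n) :
    Coord n →ₗ[ℝ] Coord n →ₗ[ℝ] ℝ :=
  LinearMap.mk₂ ℝ (fun a b => christoffel p a b c)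
    (fun u u' v => by
      simp only [christoffel_eq hp, Prod.fst_add, inner_add_left, inner_add_right]; ring)
    (fun k u v => by
      simp only [christoffel_eq hp, Prod.smul_fst, real_inner_smul_left, real_inner_smul_right,
        smul_eq_mul]; ring)
    (fun u v v' => by
      simp only [christoffel_eq hp, Prod.fst_add, inner_add_left, inner_add_right]; ring)
    (fun k u v => by
      simp only [christoffel_eq hp, Prod.smul_fst, real_inner_smul_left, real_inner_smul_right,
        smul_eq_mul]; ring)

theorem metric_comm (p a b : Coord n) : metric p a b = metric p b a := by
  simp only [metric, real_inner_comm a.1, mul_comm]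

theorem christoffel_comm {p : Coord n} (hp : p ∈ space n) (a b c : Coord n) :
    christoffel p a b c = christoffel p b a c := by
  simp only [christoffel_eq hp, real_inner_comm a.1 b.1]
  ring

theorem christoffel_smul_right {p : Coord n} (hp : p ∈ space n) (k : ℝ) (a b c : Coord n) :
    christoffel p a b (k • c) = k * christoffel p a b c := by
  simp only [christoffel_eq hp, Prod.smul_fst, real_inner_smul_right]
  ring

theorem metric_smul_right (p : Coord n) (k : ℝ) (a b : Coord n) :
    metric p a (k • b) = k * metric p a b :=
  map_smul (metricBilin p a) k b

end Barrier

theorem hasDerivAt_fderiv_along_line {E F : Type*} [NormedAddCommGroup E] [NormedSpace ℝ E]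
    [NormedAddCommGroup F] [NormedSpace ℝ F] {f : E → F} {y : E}
    (hf : DifferentiableAt ℝ (fderiv ℝ f) y) (u : E) :
    HasDerivAt (fun s : ℝ => fderiv ℝ f (y + s • u) u) (fderiv ℝ (fderiv ℝ f) y u u) 0 := by
  have hline : HasDerivAt (fun s : ℝ => y + s • u) u 0 := by
    simpa using ((hasDerivAt_id (0 : ℝ)).smul_const u).const_add y
  have h0 : HasFDerivAt (fderiv ℝ f) (fderiv ℝ (fderiv ℝ f) y) (y + (0 : ℝ) • u) := by
    rw [zero_smul, add_zero]
    exact hf.hasFDerivAt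
  exact ((ContinuousLinearMap.apply ℝ F u).hasFDerivAt).comp_hasDerivAt (0 : ℝ)
    (h0.comp_hasDerivAt (0 : ℝ) hline)

/-! ### Curvature at a local maximum of the barrier. -/

section Tangency

variable {n : ℕ} {f : EuclideanSpace ℝ (Fin n) → Coord n} {y : EuclideanSpace ℝ (Fin n)}

theorem meanCurvature_pos_of_secondForm_pos (hf : ContDiffAt ℝ 2 f y) (hy : f y ∈ space n)
    (hinj : Function.Injective (fderiv ℝ f y)) {N : Coord n}
    (hpos : ∀ u, u ≠ 0 → 0 < secondForm f y N u u) {j : ℕ} (hj : j ≤ n) :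
    0 < meanCurvature f y j N := by
  have hsymm : IsSymmSndFDerivAt ℝ f y := hf.isSymmSndFDerivAt (by simp)
  let D : EuclideanSpace ℝ (Fin n) →ₗ[ℝ] Coord n := fderiv ℝ f y
  have hA := posDef_of_bilinear ((metricBilin (f y)).compl₁₂ D D)
    (fun u v => metric_comm _ _ _)
    (fun u hu => metric_self_pos hy fun h => hu (hinj (h.trans (map_zero _).symm)))
  let B : EuclideanSpace ℝ (Fin n) →ₗ[ℝ] EuclideanSpace ℝ (Fin n) →ₗ[ℝ] ℝ :=
    (fderiv ℝ (fderiv ℝ f) y).toLinearMap₁₂.compr₂ ((metricBilin (f y)).flip N)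
      + (christoffelBilin hy N).compl₁₂ D D
  have hB := posDef_of_bilinear B
    (fun u v => by
      change secondForm f y N u v = secondForm f y N v u
      rw [secondForm, secondForm, hsymm.eq, christoffel_comm hy]) hpos
  exact div_pos (esymm_roots_charpoly_inv_mul_pos hA hB hj)
    (Nat.cast_pos.2 (Nat.choose_pos hj))

theorem exists_unitNormal_meanCurvature_pos (hf : ContDiffAt ℝ 2 f y) (hy : f y ∈ space n)
    (hinj : Function.Injective (fderiv ℝ f y)) {σ ε : ℝ} (hσ : σ ≠ 0) (hε : 0 < ε)
    (hmax : IsLocalMax (fun z => barrier σ ε (f z)) y) {j : ℕ} (hj : j ≤ n) :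
    ∃ N, IsUnitNormal f y N ∧ 0 < meanCurvature f y j N := by
  set W := barrierGrad σ ε (f y) with hWdef
  have hWne : W ≠ 0 := fun h => hσ (congrArg Prod.snd h)
  have hWpos := metric_self_pos hy hWne
  have hdiff : ∀ᶠ z in nhds y, HasFDerivAt f (fderiv ℝ f z) z :=
    (hf.eventually (by simp)).mono fun z hz => (hz.differentiableAt (by simp)).hasFDerivAt
  have hD2 : DifferentiableAt ℝ (fderiv ℝ f) y :=
    (hf.fderiv_right (m := 1) (by norm_num)).differentiableAt (by simp)
  have hline : ∀ u s, HasDerivAt (fun s : ℝ => y + s • u) u s := fun u s => by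
    simpa using ((hasDerivAt_id s).smul_const u).const_add y
  have hlim : ∀ u, Filter.Tendsto (fun s : ℝ => y + s • u) (nhds 0) (nhds y) := fun u => by
    simpa using (hline u 0).continuousAt.tendsto
  have hcurve : ∀ u, ∀ᶠ s in nhds (0 : ℝ),
      HasDerivAt (fun s : ℝ => f (y + s • u)) (fderiv ℝ f (y + s • u) u) s := fun u =>
    ((hlim u).eventually hdiff).mono fun s hs => hs.comp_hasDerivAt s (hline u s)
  have hkey : ∀ u, metric (f y) (fderiv ℝ f y u) W = 0 ∧
      metric (f y) (fderiv ℝ (fderiv ℝ f) y u u) W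
        + christoffel (f y) (fderiv ℝ f y u) (fderiv ℝ f y u) W
        + 4 * ε * (1 + ‖(f y).1‖ ^ 2) * ‖(fderiv ℝ f y u).1‖ ^ 2 / (1 - ‖(f y).1‖ ^ 2) ^ 3 ≤ 0 := by
    intro u
    have hy0 : y + (0 : ℝ) • u = y := by rw [zero_smul, add_zero]
    have hmaxu : IsLocalMax (fun s : ℝ => barrier σ ε (f (y + s • u))) 0 := by
      have h := (hlim u).eventually hmax
      simpa only [IsLocalMax, IsMaxFilter, zero_smul, add_zero] using h
    have h := metric_barrierGrad_of_isLocalMax (c := fun s : ℝ => f (y + s • u))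
      (c' := fun s : ℝ => fderiv ℝ f (y + s • u) u) (hcurve u)
      (hasDerivAt_fderiv_along_line hD2 u) (by rwa [hy0]) hmaxu
    rwa [hy0] at h
  set l := Real.sqrt (metric (f y) W W) with hl
  have hlpos : 0 < l := Real.sqrt_pos.2 hWpos
  have hlsq : l * l = metric (f y) W W := Real.mul_self_sqrt hWpos.le
  -- The sign turns the negative definite second form along `W` into a positive definite one.
  refine ⟨(-l⁻¹) • W, ⟨?_, fun u => ?_⟩,
    meanCurvature_pos_of_secondForm_pos hf hy hinj (fun u hu => ?_) hj⟩
  · rw [metric_smul_right, metric_comm, metric_smul_right, ← hlsq]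
    field_simp
  · rw [metric_smul_right, (hkey u).1, mul_zero]
  · rw [secondForm, metric_smul_right, christoffel_smul_right hy, ← mul_add, neg_mul_comm]
    refine mul_pos (inv_pos.2 hlpos) (neg_pos.2 ?_)
    -- `W` has vertical component `σ ≠ 0`, so a vertical vector orthogonal to it vanishes.
    have ha : (fderiv ℝ f y u).1 ≠ 0 := fun ha => by
      have h2 := (hkey u).1
      rw [metric, ha, inner_zero_left, zero_div, zero_add] at h2
      have h2' : (fderiv ℝ f y u).2 = 0 := (mul_eq_zero.1 h2).resolve_right hσ
      exact hu (hinj ((Prod.ext ha h2').trans (map_zero _).symm))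
    have hs := one_sub_norm_sq_pos hy
    have hn := norm_pos_iff.2 ha
    have hHess : 0 < 4 * ε * (1 + ‖(f y).1‖ ^ 2) * ‖(fderiv ℝ f y u).1‖ ^ 2
        / (1 - ‖(f y).1‖ ^ 2) ^ 3 := by positivity
    linarith [(hkey u).2]

end Tangency

/-! ### Compactness and the height bound. -/

section MaximumPrinciple

variable {n : ℕ}

/-- The compactification is compact, so it suffices that the image there is closed. A limit point at
infinity would be asymptotic, hence of finite height with `σ t ≤ c < c'`. -/
theorem isCompact_superlevel {A : Set (Coord n)} (hA : A ⊆ space n)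
    (hclosed : closure A ∩ space n ⊆ A) {σ c c' : ℝ} (hc : c < c')
    (hasymp : ∀ q ∈ asymptoticBoundary A, ∃ t : ℝ, q.2 = t ∧ σ * t ≤ c) :
    IsCompact {p | p ∈ A ∧ c' ≤ σ * p.2} := by
  set K := {p | p ∈ A ∧ c' ≤ σ * p.2}
  let e : Coord n → EuclideanSpace ℝ (Fin n) × EReal := fun p => (p.1, (p.2 : EReal))
  have he : Topology.IsInducing e :=
    Topology.IsInducing.id.prodMap EReal.isEmbedding_coe.isInducing
  have hlevel : closure K ⊆ {p | c' ≤ σ * p.2} :=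
    closure_minimal (fun p hp => hp.2)
      (isClosed_le continuous_const (continuous_const.mul continuous_snd))
  have hball : closure (e '' K) ⊆ Metric.closedBall 0 1 ×ˢ Set.univ := by
    refine closure_minimal ?_ (Metric.isClosed_closedBall.prod isClosed_univ)
    rintro _ ⟨p, hp, rfl⟩
    have hp1 : ‖p.1‖ < 1 := hA hp.1
    exact ⟨by simpa [e] using hp1.le, trivial⟩
  have hcl : IsClosed (e '' K) := by
    refine isClosed_of_closure_subset fun q hq => ?_
    have hq1 : ‖q.1‖ ≤ 1 := by simpa using (hball hq).1
    have hqA : q ∈ closure (e '' A) := closure_mono (Set.image_mono fun p hp => hp.1) hq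
    have hreal : ∃ t : ℝ, q.2 = t := by
      by_cases hinf : q.2 = ⊤ ∨ q.2 = ⊥
      · obtain ⟨t, ht, -⟩ := hasymp q ⟨Or.inr ⟨hq1, hinf⟩, hqA⟩
        exact ⟨t, ht⟩
      · rw [not_or] at hinf
        exact ⟨q.2.toReal, (EReal.coe_toReal hinf.1 hinf.2).symm⟩
    obtain ⟨t, ht⟩ := hreal
    have hqe : e (q.1, t) = q := Prod.ext rfl ht.symm
    have hcK : ((q.1, t) : Coord n) ∈ closure K := by
      rw [he.closure_eq_preimage_closure_image, Set.mem_preimage, hqe]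
      exact hq
    have hct : c' ≤ σ * t := hlevel hcK
    have hlt : ‖q.1‖ < 1 := by
      refine lt_of_le_of_ne hq1 fun h1 => ?_
      obtain ⟨t', ht', hle⟩ := hasymp q ⟨Or.inl ⟨t, h1, ht⟩, hqA⟩
      have : t' = t := EReal.coe_injective (ht'.symm.trans ht)
      subst this
      linarith
    exact ⟨(q.1, t), ⟨hclosed ⟨closure_mono (fun p hp => hp.1) hcK, hlt⟩, hct⟩, hqe⟩
  rw [he.isCompact_iff]
  exact ((isCompact_closedBall _ _).prod isCompact_univ).of_isClosed_subset hcl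
    (subset_closure.trans hball)

theorem continuousOn_barrier (σ ε : ℝ) : ContinuousOn (barrier (n := n) σ ε) (space n) :=
  ((continuous_const.mul continuous_snd).continuousOn).add
    (continuousOn_const.mul (continuousOn_const.div
      (continuous_const.sub (continuous_fst.norm.pow 2)).continuousOn
      fun _ hp => (one_sub_norm_sq_pos hp).ne'))

/-- On a compact set, a small multiple of the convex function can be added to the height without
the maximum falling below a level that the height exceeds. -/
theorem exists_isMaxOn_barrier {K : Set (Coord n)} (hK : IsCompact K) (hsub : K ⊆ space n)
    {σ c : ℝ} {p₀ : Coord n} (hp₀ : p₀ ∈ K) (hc : c < σ * p₀.2) :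
    ∃ ε > 0, ∃ p ∈ K, IsMaxOn (barrier σ ε) K p ∧ c < σ * p.2 := by
  obtain ⟨C, hC⟩ := hK.bddAbove_image ((continuousOn_barrier 0 1).mono hsub)
  have hCle : ∀ p ∈ K, 2 / (1 - ‖p.1‖ ^ 2) ≤ C := fun p hp => by
    simpa [barrier] using hC (Set.mem_image_of_mem _ hp)
  have hpos : ∀ p ∈ K, 0 < 2 / (1 - ‖p.1‖ ^ 2) := fun p hp =>
    div_pos two_pos (one_sub_norm_sq_pos (hsub hp))
  have hC0 : 0 < C := (hpos p₀ hp₀).trans_le (hCle p₀ hp₀)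
  -- With this `ε` the added term is at most `σ * p₀.2 - c` on `K`, exactly the margin available;
  -- its positivity at `p₀` makes the final inequality strict.
  have hε : 0 < (σ * p₀.2 - c) / C := div_pos (sub_pos.2 hc) hC0
  obtain ⟨p, hp, hmax⟩ := hK.exists_isMaxOn ⟨p₀, hp₀⟩ ((continuousOn_barrier σ _).mono hsub)
  refine ⟨_, hε, p, hp, hmax, ?_⟩
  have h1 : barrier σ _ p₀ ≤ barrier σ _ p := hmax hp₀
  have h2 := mul_le_mul_of_nonneg_left (hCle p hp) hε.le
  have h3 := mul_pos hε (hpos p₀ hp₀)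
  rw [div_mul_cancel₀ _ hC0.ne'] at h2
  simp only [barrier] at h1
  linarith

variable [NeZero n] {M : Type*} [TopologicalSpace M] [ChartedSpace (EuclideanHalfSpace n) M]
  {X : M → Coord n}

theorem IsImmersedHypersurface.contDiffAt_chart
    (hX : IsImmersedHypersurface X) {p : M} (hp : p ∈ (𝓡∂ n).interior M) :
    ContDiffAt ℝ ∞ (X ∘ (extChartAt (𝓡∂ n) p).symm) (extChartAt (𝓡∂ n) p p) :=
  (contMDiffAt_iff.1 (hX.contMDiff p)).2.contDiffAt (mem_interior_iff_mem_nhds.1 hp)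

theorem IsImmersedHypersurface.injective_fderiv_chart
    (hX : IsImmersedHypersurface X) {p : M} (hp : p ∈ (𝓡∂ n).interior M) :
    Function.Injective (fderiv ℝ (X ∘ (extChartAt (𝓡∂ n) p).symm) (extChartAt (𝓡∂ n) p p)) := by
  have h := hX.injective_mfderiv p
  rw [((hX.contMDiff p).mdifferentiableAt (by simp)).mfderiv,
    fderivWithin_of_mem_nhds (mem_interior_iff_mem_nhds.1 hp)] at h
  exact h

theorem IsRMinimal.height_le {r : ℕ} (hr : r + 1 ≤ n)
    (hX : IsImmersedHypersurface X) (hclosed : closure (Set.range X) ∩ space n ⊆ Set.range X)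
    (hmin : IsRMinimal r X) {σ c : ℝ} (hσ : σ ≠ 0)
    (hfin : ∀ q ∈ finiteBoundary X, σ * q.2 ≤ c)
    (hasymp : ∀ q ∈ asymptoticBoundary (Set.range X), ∃ t : ℝ, q.2 = t ∧ σ * t ≤ c) (p₀ : M) :
    σ * (X p₀).2 ≤ c := by
  by_contra! hp₀
  -- The gap `c < c'` gives compactness; the gap `c' < σ * (X p₀).2` keeps the maximum strictly
  -- above the cut.
  obtain ⟨c', hc, hc'⟩ := exists_between hp₀
  have hspace : Set.range X ⊆ space n := Set.range_subset_iff.2 hX.mem_space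
  obtain ⟨ε, hε, _, ⟨⟨p, rfl⟩, -⟩, hmax, hpc⟩ := exists_isMaxOn_barrier
    (isCompact_superlevel hspace hclosed hc hasymp) (fun q hq => hspace hq.1)
    ⟨Set.mem_range_self p₀, hc'.le⟩ hc'
  have hint : p ∈ (𝓡∂ n).interior M := by
    by_contra hnot
    have hbd : p ∈ (𝓡∂ n).boundary M := by rwa [← ModelWithCorners.compl_interior]
    linarith [hfin _ (Set.mem_image_of_mem X hbd)]
  have hf := hX.contDiffAt_chart hint
  have hfp : (X ∘ (extChartAt (𝓡∂ n) p).symm) (extChartAt (𝓡∂ n) p p) = X p :=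
    congrArg X (extChartAt_to_inv p)
  have hlocal : IsLocalMax (fun z => barrier σ ε ((X ∘ (extChartAt (𝓡∂ n) p).symm) z))
      (extChartAt (𝓡∂ n) p p) := by
    have hcont := (continuousAt_const (y := σ)).mul (continuousAt_snd.comp hf.continuousAt)
    -- Being strictly above level `c'` is an open condition, so nearby points of `M` also lie in the
    -- compact piece.
    have hev := hcont.eventually
      (lt_mem_nhds (hpc.trans_eq (congrArg (fun q => σ * q.2) hfp.symm)))
    filter_upwards [hev] with z hz
    rw [hfp]
    exact hmax ⟨Set.mem_range_self _, hz.le⟩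
  obtain ⟨N, hN, hpos⟩ := exists_unitNormal_meanCurvature_pos (contDiffAt_infty.1 hf 2)
    (hX.mem_space _) (hX.injective_fderiv_chart hint) hσ hε hlocal hr
  exact hpos.ne' (hmin p hint N hN)

end MaximumPrinciple

end HypProduct

end

theorem mainTheorem5 {n : ℕ} [NeZero n] (hn : 2 ≤ n) (r : ℕ) (hr : r + 1 ≤ n)
    {M : Type*} [TopologicalSpace M] [ChartedSpace (EuclideanHalfSpace n) M]
    [IsManifold (𝓡∂ n) ∞ M]
    (X : M → HypProduct.Coord n) (hX : HypProduct.IsImmersedHypersurface X)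
    (hclosed : closure (Set.range X) ∩ HypProduct.space n ⊆ Set.range X)
    (hmin : HypProduct.IsRMinimal r X)
    (t₀ t₁ : ℝ) (ht : t₀ ≤ t₁)
    (hfin : HypProduct.finiteBoundary X ⊆ HypProduct.slab n t₀ t₁)
    (hasymp : HypProduct.asymptoticBoundary (Set.range X) ⊆ HypProduct.slabAtInfinity n t₀ t₁) :
    Set.range X ⊆ HypProduct.slab n t₀ t₁ := by
  have hreal : ∀ q ∈ HypProduct.asymptoticBoundary (Set.range X),
      ∃ t : ℝ, q.2 = t ∧ t₀ ≤ t ∧ t ≤ t₁ := fun q hq => by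
    obtain ⟨-, h0, h1⟩ := hasymp hq
    have hq2 : ((q.2.toReal : ℝ) : EReal) = q.2 := EReal.coe_toReal
      (h1.trans_lt (EReal.coe_lt_top _)).ne ((EReal.bot_lt_coe _).trans_le h0).ne'
    rw [← hq2] at h0 h1
    exact ⟨_, hq2.symm, EReal.coe_le_coe_iff.1 h0, EReal.coe_le_coe_iff.1 h1⟩
  rintro _ ⟨p, rfl⟩
  refine ⟨hX.mem_space p, ?_, ?_⟩
  · have h := hmin.height_le hr hX hclosed (σ := -1) (c := -t₀) (by norm_num)
      (fun q hq => by linarith [(hfin hq).2.1])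
      (fun q hq => by
        obtain ⟨t, h, h0, -⟩ := hreal q hq
        exact ⟨t, h, by linarith⟩) p
    linarith
  · have h := hmin.height_le hr hX hclosed (σ := 1) (c := t₁) one_ne_zero
      (fun q hq => by linarith [(hfin hq).2.2])
      (fun q hq => by
        obtain ⟨t, h, -, h1⟩ := hreal q hq
        exact ⟨t, h, by linarith⟩) p
    linarith
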